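/- Let $\mathcal{G}=(\mathcal{N},\mathcal{E})$ be a connected undirected graph with finite node set $\mathcal{N}$, $|\mathcal{N}|\ge 2$; write $\mathcal{N}_i$ for the set of neighbours of node $i$ and $d_i=|\mathcal{N}_i|$. All spaces are finite-dimensional real inner product spaces. For each $i\in\mathcal{N}$ let $f_i:\mathbb{R}^{n_i}\to\mathbb{R}\cup\{+\infty\}$ be convex, closed and proper, let $A_i:\mathbb{R}^{n_i}\to\mathbb{R}^m$ be linear with adjoint $A_i^*$, and let $b_i\in\mathbb{R}^m$. Let $\mathcal{K}\subseteq\mathbb{R}^m$ be a nonempty closed convex cone with polar cone $\mathcal{K}^\circ=\{y : \langle x,y\rangle\le 0 \text{ for all } x\in\mathcal{K}\}$. Write $\mathcal{I}_C$ for the indicator function of a set $C$ (equal to $0$ on $C$ and $+\infty$ elsewhere), $\Pi_C$ for the projection onto a nonempty closed convex set $C$, and $f^*(u)=\sup_x\{\langle u,x\rangle-f(x)\}$ for the conjugate of a function $f$. Consider the primal problem $$(\mathcal{P})\qquad \text{minimize } \sum_{i\in\mathcal{N}} f_i(x_i)\quad\text{subject to}\quad \sum_{i\in\mathcal{N}}(A_ix_i-b_i)\in\mathcal{K}$$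 and the dual problem $$(\mathcal{D})\qquad \text{maximize } -\sum_{i\in\mathcal{N}}\bigl(f_i^*(-A_i^*y)+\langle y,b_i\rangle+\mathcal{I}_{\mathcal{K}^\circ}(y)\bigr)\quad\text{over } y\in\mathbb{R}^m,$$ and assume that $(\mathcal{P})$ has a minimizer, $(\mathcal{D})$ has a maximizer, and their optimal values are equal. Let $\rho>0$, let $y_i^0\in\mathbb{R}^m$ ($i\in\mathcal{N}$) be arbitrary, let $p_i^0=0$, and let the sequences $(p_i^k)$, $(r_i^k)$, $(x_i^k)$, $(t_i^k)$, $(y_i^k)$ be generated by the aggregate dual consensus ADMM, i.e., for all $k\ge 0$ and $i\in\mathcal{N}$, $$p_i^{k+1}=p_i^k+\rho\sum_{j\in\mathcal{N}_i}(y_i^k-y_j^k),\qquad r_i^{k+1}=\rho\sum_{j\in\mathcal{N}_i}(y_i^k+y_j^k)-(b_i+p_i^{k+1}),$$ $$(x_i^{k+1},t_i^{k+1})\in\operatorname*{argmin}_{(x_i,t_i)}\Bigl\{f_i(x_i)+\mathcal{I}_{\mathcal{K}}(t_i)+\tfrac{1}{4\rho d_i}\|A_ix_i+r_i^{k+1}-t_i\|^2\Bigr\},$$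 $$y_i^{k+1}=\tfrac{1}{2\rho d_i}\,\Pi_{\mathcal{K}^\circ}\bigl(A_ix_i^{k+1}+r_i^{k+1}\bigr),$$ where any choice of a minimizer is allowed. Then there is a maximizer $y^\star$ of $(\mathcal{D})$ such that $y_i^k\to y^\star$ as $k\to\infty$ for every $i\in\mathcal{N}$. Moreover, every limit point of the sequence $\bigl((x_i^k)_{i\in\mathcal{N}}\bigr)_k$ is a minimizer of $(\mathcal{P})$. -/

import Mathlib

open Filter Topology

/-- The epigraph `{(x, c) : f x ≤ c}` of an extended-real-valued function. -/
def epigraph {E : Type*} (f : E → EReal) : Set (E × ℝ) :=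
  {q | f q.1 ≤ (q.2 : EReal)}

/-- `f : E → ℝ ∪ {+∞}` is convex, closed and proper: its epigraph is convex and closed, it never
takes the value `-∞`, and it is not identically `+∞`. -/
structure IsConvexClosedProper {E : Type*} [NormedAddCommGroup E] [InnerProductSpace ℝ E]
    (f : E → EReal) : Prop where
  convex : Convex ℝ (epigraph f)
  closed : IsClosed (epigraph f)
  ne_bot : ∀ x, f x ≠ ⊥
  exists_ne_top : ∃ x, f x ≠ ⊤

/-- The conjugate `f^*(u) = sup_x {⟨u, x⟩ - f x}`. -/
noncomputable def conjugate {E : Type*} [NormedAddCommGroup E] [InnerProductSpace ℝ E]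
    (f : E → EReal) (u : E) : EReal :=
  ⨆ x : E, ((inner ℝ u x : ℝ) : EReal) - f x

open Classical in
/-- The indicator function of a set: `0` on the set, `+∞` outside. -/
noncomputable def indicatorFn {E : Type*} (C : Set E) (x : E) : EReal :=
  if x ∈ C then 0 else ⊤

/-- The polar cone `{y : ⟨x, y⟩ ≤ 0 for all x ∈ C}`. -/
def polarCone {E : Type*} [NormedAddCommGroup E] [InnerProductSpace ℝ E] (C : Set E) : Set E :=
  {y | ∀ x ∈ C, inner ℝ x y ≤ 0}

/-- `q` is the projection of `z` onto `C`, i.e. `q` is the point of `C` nearest to `z`. -/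
def IsProjection {E : Type*} [NormedAddCommGroup E] [InnerProductSpace ℝ E]
    (C : Set E) (z q : E) : Prop :=
  q ∈ C ∧ IsMinOn (fun c => ‖z - c‖) C q

/-- The data of the problem: minimize `∑ i, f i (x i)` subject to
`∑ i, (A i (x i) - b i) ∈ K`. -/
structure ResourceProblem (V : Type*) (E : V → Type*) (F : Type*)
    [∀ i, NormedAddCommGroup (E i)] [∀ i, InnerProductSpace ℝ (E i)]
    [NormedAddCommGroup F] [InnerProductSpace ℝ F] where
  /-- the local objective functions -/
  f : ∀ i, E i → EReal
  /-- the local constraint maps -/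
  A : ∀ i, E i →ₗ[ℝ] F
  /-- the local offsets -/
  b : V → F
  /-- the cone of the coupling constraint -/
  K : ConvexCone ℝ F

namespace ResourceProblem

variable {V : Type*} [Fintype V] {E : V → Type*} {F : Type*}
  [∀ i, NormedAddCommGroup (E i)] [∀ i, InnerProductSpace ℝ (E i)]
  [NormedAddCommGroup F] [InnerProductSpace ℝ F]

/-- The primal objective `∑ i, f i (x i)`. -/
noncomputable def primalObj (P : ResourceProblem V E F) (x : ∀ i, E i) : EReal :=
  ∑ i, P.f i (x i)

/-- The primal feasible set `{x : ∑ i, (A i (x i) - b i) ∈ K}`. -/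
def feasibleSet (P : ResourceProblem V E F) : Set (∀ i, E i) :=
  {x | ∑ i, (P.A i (x i) - P.b i) ∈ P.K}

/-- `x` is a minimizer of the primal problem. -/
def IsPrimalSolution (P : ResourceProblem V E F) (x : ∀ i, E i) : Prop :=
  x ∈ P.feasibleSet ∧ IsMinOn P.primalObj P.feasibleSet x

/-- The dual objective
`-∑ i, (f i ^* (-(A i)^* y) + ⟨y, b i⟩ + indicator of the polar cone of K at y)`. -/
noncomputable def dualObj [∀ i, FiniteDimensional ℝ (E i)] [FiniteDimensional ℝ F]
    (P : ResourceProblem V E F) (y : F) : EReal :=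
  -∑ i, (conjugate (P.f i) (-(LinearMap.adjoint (P.A i) y)) + ((inner ℝ y (P.b i) : ℝ) : EReal)
    + indicatorFn (polarCone (P.K : Set F)) y)

/-- `y` is a maximizer of the dual problem. -/
def IsDualSolution [∀ i, FiniteDimensional ℝ (E i)] [FiniteDimensional ℝ F]
    (P : ResourceProblem V E F) (y : F) : Prop :=
  IsMaxOn P.dualObj Set.univ y

/-- The standing assumptions on the problem: every `f i` is convex, closed and proper; `K` is a
nonempty closed convex cone; a primal solution and a dual solution exist and the duality gap
is zero. -/
structure StandingAssumption [∀ i, FiniteDimensional ℝ (E i)] [FiniteDimensional ℝ F]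
    (P : ResourceProblem V E F) : Prop where
  convexClosedProper : ∀ i, IsConvexClosedProper (P.f i)
  cone_nonempty : (P.K : Set F).Nonempty
  cone_closed : IsClosed (P.K : Set F)
  primal_dual : ∃ x y, P.IsPrimalSolution x ∧ P.IsDualSolution y ∧ P.primalObj x = P.dualObj y

/-- The objective of the local subproblem of agent `i`, as a function of the pair `(ξ, τ)`:
`f i ξ + (indicator of K at τ) + ‖A i ξ + r - τ‖² / (4 ρ d)`. -/
noncomputable def localObj (P : ResourceProblem V E F) (ρ : ℝ) (d : ℕ) (i : V) (r : F)
    (q : E i × F) : EReal :=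
  P.f i q.1 + indicatorFn (P.K : Set F) q.2
    + ((1 / (4 * ρ * (d : ℝ)) * ‖P.A i q.1 + r - q.2‖ ^ 2 : ℝ) : EReal)

/-- The sequences `p, r, x, t, y` are generated by the aggregate dual consensus ADMM over the
graph `G` with parameter `ρ`. The start `y 0` is arbitrary, `p 0 = 0`, and the terms of index `0`
of `r`, `x` and `t` play no role. The minimizer of the local subproblem need not be unique: any
choice of a minimizer is allowed. -/
structure IsAggregateADMM (P : ResourceProblem V E F) (G : SimpleGraph V) [DecidableRel G.Adj]
    (ρ : ℝ) (p r : ℕ → V → F) (x : ℕ → ∀ i, E i) (t y : ℕ → V → F) : Prop where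
  p_zero : ∀ i, p 0 i = 0
  p_succ : ∀ k i, p (k + 1) i = p k i + ρ • ∑ j ∈ G.neighborFinset i, (y k i - y k j)
  r_succ : ∀ k i, r (k + 1) i
    = ρ • ∑ j ∈ G.neighborFinset i, (y k i + y k j) - (P.b i + p (k + 1) i)
  xt_succ : ∀ k i,
    IsMinOn (P.localObj ρ (G.degree i) i (r (k + 1) i)) Set.univ (x (k + 1) i, t (k + 1) i)
  y_succ : ∀ k i, ∃ q : F,
    IsProjection (polarCone (P.K : Set F)) (P.A i (x (k + 1) i) + r (k + 1) i) q ∧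
      y (k + 1) i = (1 / (2 * ρ * (G.degree i : ℝ))) • q

end ResourceProblem

/-! Write g_i for `dualTerm i`, so that the dual problem minimizes ∑ g_i. Optimality in the local
subproblem and the Moreau decomposition of A_i x_i + r_i along K and its polar give s_i := b_i + t_i
- A_i x_i ∈ ∂g_i(y_i) from index 1 on. The updates then read s_i^{k+1} + p_i^{k+2} + ρ ∑_j
((y_i^{k+1} + y_j^{k+1}) - (y_i^k + y_j^k)) = 0, and p_i is ρ times the divergence of an
antisymmetric edge flow u because p^0 = 0. The zero gap provides c and sbar_i ∈ ∂g_i(c) with ∑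
sbar_i = 0 (`StandingAssumption.exists_isSubgradient`); on a connected graph -sbar/ρ is the
divergence of a flow w (`Connected.exists_flow`).

Monotonicity of ∂g_i makes the energy ∑ (‖u_ij - w_ij‖² + ‖y_i + y_j - 2c‖²) decrease, and the
decrement bounds the disagreement across edges and the change of the edge sums
(`consensusEnergy_step`). Both vanish in the limit, so a cluster point is again such a pair (c, w),
since the graphs of ∂g_i are closed. The energy relative to this new pair is monotone and tends to 0
along a subsequence, hence tends to 0. Thus y and s converge entirely
(`exists_tendsto_of_consensus_iteration`).

Where x converges along a subsequence, so does t = s - b + A x. The KKT conditions pass to the limit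
and are sufficient (`isPrimalSolution_of_isSubgradient`). -/

open scoped InnerProductSpace

/-! ### Sums over darts, and flows on a connected graph. -/

namespace SimpleGraph

variable {V : Type*} [Fintype V] (G : SimpleGraph V) [DecidableRel G.Adj]

/-- A sum over the darts of a graph is invariant under reversal of the darts. -/
theorem sum_sum_neighborFinset_comm {M : Type*} [AddCommMonoid M] (φ : V → V → M) :
    ∑ i, ∑ j ∈ G.neighborFinset i, φ i j = ∑ i, ∑ j ∈ G.neighborFinset i, φ j i :=
  Finset.sum_comm' fun i j => by simp [G.adj_comm]

theorem sum_sum_neighborFinset_eq_zero {F : Type*} [AddCommGroup F] [Module ℝ F]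
    (u : V → V → F) (hu : ∀ i j, G.Adj i j → u j i = -u i j) :
    ∑ i, ∑ j ∈ G.neighborFinset i, u i j = 0 := by
  have h : ∑ i, ∑ j ∈ G.neighborFinset i, u i j = -∑ i, ∑ j ∈ G.neighborFinset i, u i j := by
    conv_lhs => rw [G.sum_sum_neighborFinset_comm]
    simp only [← Finset.sum_neg_distrib]
    exact Finset.sum_congr rfl fun i _ => Finset.sum_congr rfl fun j hj =>
      hu i j (by simpa using hj)
  have h2 : (2 : ℝ) • ∑ i, ∑ j ∈ G.neighborFinset i, u i j = 0 := by
    rw [two_smul]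
    nth_rewrite 2 [h]
    exact add_neg_cancel _
  exact (smul_eq_zero.mp h2).resolve_left two_ne_zero

end SimpleGraph

namespace SimpleGraph

variable {V : Type*} {G : SimpleGraph V}

theorem Connected.eq_of_forall_adj {α : Type*} (hG : G.Connected) {φ : V → α}
    (h : ∀ i j, G.Adj i j → φ i = φ j) (i j : V) : φ i = φ j := by
  obtain ⟨w⟩ := hG.preconnected i j
  induction w with
  | nil => rfl
  | cons hadj _ ih => exact (h _ _ hadj).trans ih

variable [Fintype V] [DecidableRel G.Adj]

theorem Connected.exists_adj [Nontrivial V] (hG : G.Connected) (i : V) : ∃ j, G.Adj i j :=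
  (G.degree_pos_iff_exists_adj i).mp (hG.preconnected.degree_pos_of_nontrivial i)

theorem Connected.degree_pos [Nontrivial V] (hG : G.Connected) (i : V) : 0 < G.degree i :=
  (G.degree_pos_iff_exists_adj i).mpr (hG.exists_adj i)

/-- On a connected graph every family with zero sum is the divergence of a flow. -/
theorem Connected.exists_flow {F : Type*} [AddCommGroup F] [Module ℝ F] (hG : G.Connected)
    (q : V → F) (hq : ∑ i, q i = 0) :
    ∃ u : V → V → F, (∀ i j, u j i = -u i j) ∧ ∀ i, ∑ j ∈ G.neighborFinset i, u i j = q i := by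
  classical
  -- Divergences form a subgroup. A unit of flow along an edge puts `single i c - single j c` into
  -- it, paths extend this to all pairs, and such differences generate the families of zero sum.
  let S : AddSubgroup (V → F) :=
    { carrier := {q | ∃ u : V → V → F, (∀ i j, u j i = -u i j) ∧
        ∀ i, ∑ j ∈ G.neighborFinset i, u i j = q i}
      zero_mem' := ⟨0, by simp, by simp⟩
      add_mem' := by
        rintro a b ⟨u, hu, hu'⟩ ⟨v, hv, hv'⟩
        refine ⟨u + v, fun i j => ?_, fun i => ?_⟩
        · simp only [Pi.add_apply, hu i j, hv i j]; abel
        · simp [Finset.sum_add_distrib, hu', hv']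
      neg_mem' := by
        rintro a ⟨u, hu, hu'⟩
        exact ⟨-u, fun i j => by simp [hu i j], fun i => by simp [hu']⟩ }
  have hadj : ∀ i j, G.Adj i j → ∀ c : F, Pi.single i c - Pi.single j c ∈ S := by
    intro i j hij c
    refine ⟨fun a e => (if a = i ∧ e = j then c else 0) - (if e = i ∧ a = j then c else 0),
      fun a e => by simp, fun a => ?_⟩
    have hne := hij.ne
    rw [Finset.sum_sub_distrib]
    congr 1
    · by_cases ha : a = i
      · subst ha
        simp [hij]
      · simp [ha]
    · by_cases ha : a = j
      · subst ha
        simp [hij.symm]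
      · simp [ha]
  have hreach : ∀ i j, ∀ c : F, Pi.single i c - Pi.single j c ∈ S := by
    intro i j c
    obtain ⟨w⟩ := hG.preconnected i j
    induction w with
    | nil => simp
    | cons h _ ih => simpa using S.add_mem (hadj _ _ h c) ih
  obtain ⟨v⟩ := hG.nonempty
  have h : q = ∑ i, (Pi.single i (q i) - Pi.single v (q i)) := by
    rw [Finset.sum_sub_distrib, Finset.univ_sum_single]
    have : ∑ i, (Pi.single v (q i) : V → F) = Pi.single v (∑ i, q i) :=
      (map_sum (AddMonoidHom.single (fun _ : V => F) v) q Finset.univ).symm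
    rw [this, hq]
    simp
  rw [h]
  exact S.sum_mem fun i _ => hreach i v (q i)

end SimpleGraph

/-! ### Convergence of the consensus iteration for monotone relations. -/

section Consensus

variable {V : Type*} [Fintype V] {F : Type*} [NormedAddCommGroup F] [InnerProductSpace ℝ F]

/-- The energy of the consensus iteration relative to the consensus value `c` and the flow `w`. -/
noncomputable def consensusEnergy (G : SimpleGraph V) [DecidableRel G.Adj] (y : V → F)
    (u : V → V → F) (c : F) (w : V → V → F) : ℝ :=
  ∑ i, ∑ j ∈ G.neighborFinset i, (‖u i j - w i j‖ ^ 2 + ‖y i + y j - (2 : ℝ) • c‖ ^ 2)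

variable {G : SimpleGraph V} [DecidableRel G.Adj]

theorem consensusEnergy_nonneg (y : V → F) (u : V → V → F) (c : F) (w : V → V → F) :
    0 ≤ consensusEnergy G y u c w :=
  Finset.sum_nonneg fun _ _ => Finset.sum_nonneg fun _ _ => by positivity

theorem le_sum_sum_neighborFinset {φ : V → V → ℝ} (hφ : ∀ i j, 0 ≤ φ i j) {i j : V}
    (h : G.Adj i j) : φ i j ≤ ∑ i, ∑ j ∈ G.neighborFinset i, φ i j :=
  (Finset.single_le_sum (f := φ i) (fun j _ => hφ i j) (by simpa using h)).trans
    (Finset.single_le_sum (f := fun i => ∑ j ∈ G.neighborFinset i, φ i j)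
      (fun i _ => Finset.sum_nonneg fun j _ => hφ i j) (Finset.mem_univ i))

theorem norm_sq_flow_le_consensusEnergy (y : V → F) (u : V → V → F) (c : F) (w : V → V → F)
    {i j : V} (h : G.Adj i j) : ‖u i j - w i j‖ ^ 2 ≤ consensusEnergy G y u c w :=
  (le_add_of_nonneg_right (by positivity)).trans
    (le_sum_sum_neighborFinset (φ := fun i j => ‖u i j - w i j‖ ^ 2
      + ‖y i + y j - (2 : ℝ) • c‖ ^ 2) (fun _ _ => by positivity) h)

theorem norm_sq_sum_le_consensusEnergy (y : V → F) (u : V → V → F) (c : F) (w : V → V → F)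
    {i j : V} (h : G.Adj i j) :
    ‖y i + y j - (2 : ℝ) • c‖ ^ 2 ≤ consensusEnergy G y u c w :=
  (le_add_of_nonneg_left (by positivity)).trans
    (le_sum_sum_neighborFinset (φ := fun i j => ‖u i j - w i j‖ ^ 2
      + ‖y i + y j - (2 : ℝ) • c‖ ^ 2) (fun _ _ => by positivity) h)

/-- One step of the consensus iteration decreases the energy. -/
theorem consensusEnergy_step {y y' s sbar : V → F} {u u' w : V → V → F} {c : F} {ρ : ℝ}
    (hρ : 0 < ρ)
    (hu : ∀ i j, u' i j = u i j + (y' i - y' j)) (hanti : ∀ i j, u i j = -u j i)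
    (hw : ∀ i j, G.Adj i j → w j i = -w i j)
    (hs : ∀ i, s i + ρ • ∑ j ∈ G.neighborFinset i, u' i j
      + ρ • ∑ j ∈ G.neighborFinset i, ((y' i + y' j) - (y i + y j)) = 0)
    (hsbar : ∀ i, sbar i + ρ • ∑ j ∈ G.neighborFinset i, w i j = 0)
    (hmono : ∀ i, 0 ≤ ⟪y' i - c, s i - sbar i⟫_ℝ) :
    consensusEnergy G y' u' c w + ∑ i, ∑ j ∈ G.neighborFinset i,
      (‖y' i - y' j‖ ^ 2 + ‖(y' i + y' j) - (y i + y j)‖ ^ 2) ≤ consensusEnergy G y u c w := by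
  set φ : V → V → ℝ := fun i j =>
    ⟪y' i - c, (u' i j - w i j) + ((y' i + y' j) - (y i + y j))⟫_ℝ with hφ
  -- Subtracting `hsbar` from `hs` and pairing with `y' i - c` gives -ρ times the inner sum, which
  -- is nonnegative by monotonicity.
  have h1 : ∑ i, ∑ j ∈ G.neighborFinset i, φ i j ≤ 0 := by
    refine Finset.sum_nonpos fun i _ => ?_
    have hsi : s i - sbar i = -(ρ • ∑ j ∈ G.neighborFinset i,
        ((u' i j - w i j) + ((y' i + y' j) - (y i + y j)))) := by
      rw [eq_neg_of_add_eq_zero_left (hsbar i), Finset.sum_add_distrib, Finset.sum_sub_distrib,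
        smul_add, smul_sub]
      have := eq_neg_of_add_eq_zero_left ((add_assoc _ _ _).symm.trans (hs i))
      rw [this]
      abel
    have := hmono i
    rw [hsi, inner_neg_right, inner_smul_right, inner_sum] at this
    nlinarith
  -- Adding the reversed dart pairs the antisymmetric flow with `y' i - y' j` and the symmetric term
  -- with `y' i + y' j - 2c`; these are the cross terms of the two squares in the energy.
  have h2 : ∑ i, ∑ j ∈ G.neighborFinset i, (φ i j + φ j i) ≤ 0 := by
    simp only [Finset.sum_add_distrib]
    rw [← G.sum_sum_neighborFinset_comm φ]
    linarith
  have h3 : consensusEnergy G y' u' c w + ∑ i, ∑ j ∈ G.neighborFinset i,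
      (‖y' i - y' j‖ ^ 2 + ‖(y' i + y' j) - (y i + y j)‖ ^ 2) - consensusEnergy G y u c w
      = 2 * ∑ i, ∑ j ∈ G.neighborFinset i, (φ i j + φ j i) := by
    simp only [consensusEnergy, Finset.mul_sum, ← Finset.sum_add_distrib,
      ← Finset.sum_sub_distrib]
    refine Finset.sum_congr rfl fun i _ => Finset.sum_congr rfl fun j hj => ?_
    have hij : G.Adj i j := by simpa using hj
    have e1 : φ i j + φ j i = ⟪u' i j - w i j, y' i - y' j⟫_ℝ
        + ⟪(y' i + y' j) - (y i + y j), y' i + y' j - (2 : ℝ) • c⟫_ℝ := by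
      have ha : u' j i - w j i = -(u' i j - w i j) := by
        rw [hu, hu, hanti j i, hw i j hij]; abel
      have hb : (y' j + y' i) - (y j + y i) = (y' i + y' j) - (y i + y j) := by abel
      have hc : y' i - y' j = (y' i - c) - (y' j - c) := by abel
      have hd : y' i + y' j - (2 : ℝ) • c = (y' i - c) + (y' j - c) := by
        rw [two_smul]; abel
      simp only [hφ]
      rw [ha, hb, hc, hd]
      generalize y' i - c = α, y' j - c = β, u' i j - w i j = γ
      generalize (y' i + y' j) - (y i + y j) = δ
      rw [inner_add_right, inner_add_right, inner_neg_right, inner_sub_right, inner_add_right,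
        real_inner_comm α, real_inner_comm α, real_inner_comm β, real_inner_comm β]
      ring
    have e2 : u i j - w i j = (u' i j - w i j) - (y' i - y' j) := by rw [hu]; abel
    have e3 : y i + y j - (2 : ℝ) • c = (y' i + y' j - (2 : ℝ) • c)
        - ((y' i + y' j) - (y i + y j)) := by abel
    rw [e1, e2, e3, norm_sub_sq_real (u' i j - w i j), norm_sub_sq_real (_ - (2 : ℝ) • c),
      real_inner_comm (y' i + y' j - (2 : ℝ) • c)]
    ring
  linarith

/-- Convergence of the dual consensus iteration for closed monotone relations `S i`. -/
theorem exists_tendsto_of_consensus_iteration [Nontrivial V] [FiniteDimensional ℝ F]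
    (hG : G.Connected) {ρ : ℝ} (hρ : 0 < ρ) {S : V → Set (F × F)}
    (hclosed : ∀ i, IsClosed (S i))
    (hmono : ∀ i, ∀ a ∈ S i, ∀ b ∈ S i, 0 ≤ ⟪a.1 - b.1, a.2 - b.2⟫_ℝ)
    (hex : ∃ (c : F) (sbar : V → F), (∀ i, (c, sbar i) ∈ S i) ∧ ∑ i, sbar i = 0)
    {y p s : ℕ → V → F} (hp0 : ∀ i, p 0 i = 0)
    (hp : ∀ k i, p (k + 1) i = p k i + ρ • ∑ j ∈ G.neighborFinset i, (y k i - y k j))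
    (hs : ∀ k i, s (k + 1) i + p (k + 2) i
      + ρ • ∑ j ∈ G.neighborFinset i, ((y (k + 1) i + y (k + 1) j) - (y k i + y k j)) = 0)
    (hS : ∀ k i, (y (k + 1) i, s (k + 1) i) ∈ S i) :
    ∃ (c : F) (sbar : V → F), (∀ i, (c, sbar i) ∈ S i) ∧ ∑ i, sbar i = 0 ∧
      (∀ i, Tendsto (fun k => y k i) atTop (𝓝 c)) ∧
      ∀ i, Tendsto (fun k => s k i) atTop (𝓝 (sbar i)) := by
  -- The flow starts at `u 0 = 0`, matching `p 0 = 0`. The energy pairs `y k` with `u (k + 1)`,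
  -- which already contains the differences of `y k`.
  classical
  set u : ℕ → V → V → F := fun k i j => ∑ l ∈ Finset.range k, (y l i - y l j) with hudef
  have hu : ∀ k i j, u (k + 1) i j = u k i j + (y k i - y k j) := fun k i j =>
    Finset.sum_range_succ _ _
  have hanti : ∀ k i j, u k i j = -u k j i := fun k i j => by
    simp [hudef]
  have hpu : ∀ k i, p k i = ρ • ∑ j ∈ G.neighborFinset i, u k i j := by
    intro k i
    induction k with
    | zero => simp [hp0, hudef]
    | succ k ih => simp only [hp, ih, hu, Finset.sum_add_distrib, smul_add]
  set D : ℕ → ℝ := fun k => ∑ i, ∑ j ∈ G.neighborFinset i,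
    (‖y (k + 1) i - y (k + 1) j‖ ^ 2
      + ‖(y (k + 1) i + y (k + 1) j) - (y k i + y k j)‖ ^ 2) with hD
  have hDnonneg : ∀ k, 0 ≤ D k := fun k =>
    Finset.sum_nonneg fun _ _ => Finset.sum_nonneg fun _ _ => by positivity
  have step : ∀ (c : F) (sbar : V → F) (w : V → V → F), (∀ i, (c, sbar i) ∈ S i) →
      (∀ i j, G.Adj i j → w j i = -w i j) →
      (∀ i, sbar i + ρ • ∑ j ∈ G.neighborFinset i, w i j = 0) → ∀ k,
      consensusEnergy G (y (k + 1)) (u (k + 2)) c w + D k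
        ≤ consensusEnergy G (y k) (u (k + 1)) c w := by
    intro c sbar w hcs hw hsw k
    refine consensusEnergy_step hρ (fun i j => hu (k + 1) i j) (hanti (k + 1)) hw
      (fun i => ?_) hsw (fun i => hmono i _ (hS k i) _ (hcs i))
    rw [← hpu]
    exact hs k i
  have anti : ∀ (c : F) (sbar : V → F) (w : V → V → F), (∀ i, (c, sbar i) ∈ S i) →
      (∀ i j, G.Adj i j → w j i = -w i j) →
      (∀ i, sbar i + ρ • ∑ j ∈ G.neighborFinset i, w i j = 0) →
      Antitone fun k => consensusEnergy G (y k) (u (k + 1)) c w := by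
    intro c sbar w hcs hw hsw
    exact antitone_nat_of_succ_le fun k => by
      linarith [step c sbar w hcs hw hsw k, hDnonneg k]
  obtain ⟨c₀, s₀, hcs₀, hs₀⟩ := hex
  obtain ⟨w₀, hw₀, hw₀'⟩ := hG.exists_flow (fun i => -(ρ⁻¹ • s₀ i))
    (by simp [← Finset.smul_sum, hs₀])
  have hsw₀ : ∀ i, s₀ i + ρ • ∑ j ∈ G.neighborFinset i, w₀ i j = 0 := fun i => by
    rw [hw₀', smul_neg, smul_inv_smul₀ hρ.ne', add_neg_cancel]
  have step₀ := step c₀ s₀ w₀ hcs₀ (fun i j _ => hw₀ i j) hsw₀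
  have anti₀ := anti c₀ s₀ w₀ hcs₀ (fun i j _ => hw₀ i j) hsw₀
  set e : ℕ → ℝ := fun k => consensusEnergy G (y k) (u (k + 1)) c₀ w₀ with he
  have he0 : ∀ k, 0 ≤ e k := fun k => consensusEnergy_nonneg _ _ _ _
  have hDlim : Tendsto D atTop (𝓝 0) := by
    have hlim := tendsto_atTop_ciInf anti₀ ⟨0, by rintro _ ⟨k, rfl⟩; exact he0 k⟩
    have hlim' := hlim.sub (hlim.comp (tendsto_add_atTop_nat 1))
    rw [sub_self] at hlim'
    exact squeeze_zero hDnonneg (fun k => by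
      have := step₀ k
      simp only [Function.comp, he]
      linarith) hlim'
  have sq_lim : ∀ {a : ℕ → F} {z : ℕ → ℝ}, (∀ k, ‖a k‖ ^ 2 ≤ z k) → Tendsto z atTop (𝓝 0) →
      Tendsto a atTop (𝓝 0) := by
    intro a z haz hz
    have h := (squeeze_zero (fun k => by positivity) haz hz).sqrt
    simp only [Real.sqrt_zero, Real.sqrt_sq (norm_nonneg _)] at h
    exact tendsto_zero_iff_norm_tendsto_zero.mpr h
  have hdiff : ∀ i j, G.Adj i j →
      Tendsto (fun k => y (k + 1) i - y (k + 1) j) atTop (𝓝 0) := fun i j hij =>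
    sq_lim (fun k => (le_add_of_nonneg_right (by positivity)).trans
      (le_sum_sum_neighborFinset (φ := fun i j => ‖y (k + 1) i - y (k + 1) j‖ ^ 2
        + ‖(y (k + 1) i + y (k + 1) j) - (y k i + y k j)‖ ^ 2)
        (fun _ _ => by positivity) hij)) hDlim
  have hchange : ∀ i j, G.Adj i j →
      Tendsto (fun k => (y (k + 1) i + y (k + 1) j) - (y k i + y k j)) atTop (𝓝 0) :=
    fun i j hij => sq_lim (fun k => (le_add_of_nonneg_left (by positivity)).trans
      (le_sum_sum_neighborFinset (φ := fun i j => ‖y (k + 1) i - y (k + 1) j‖ ^ 2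
        + ‖(y (k + 1) i + y (k + 1) j) - (y k i + y k j)‖ ^ 2)
        (fun _ _ => by positivity) hij)) hDlim
  have heq : ∀ k i, s (k + 1) i = -(ρ • ∑ j ∈ G.neighborFinset i,
      (u (k + 2) i j + ((y (k + 1) i + y (k + 1) j) - (y k i + y k j)))) := fun k i => by
    have h := hs k i
    rw [hpu, add_assoc, ← smul_add, ← Finset.sum_add_distrib] at h
    exact eq_neg_of_add_eq_zero_left h
  set R : ℝ := Real.sqrt (e 0) with hR
  have hbound : ∀ {a : F} {k : ℕ}, ‖a‖ ^ 2 ≤ e k → ‖a‖ ≤ R := fun h =>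
    Real.le_sqrt_of_sq_le (h.trans (anti₀ (Nat.zero_le _)))
  -- The energy controls the flow on edges only, so the other coordinates are set to 0 to obtain a
  -- bounded sequence.
  let X : ℕ → (V → F) × (V → V → F) := fun k =>
    (fun i => y (k + 1) i - c₀, fun i j => if G.Adj i j then u (k + 2) i j - w₀ i j else 0)
  have hX : ∀ k, X k ∈ Metric.closedBall (0 : (V → F) × (V → V → F)) R := by
    intro k
    have hR0 : 0 ≤ R := Real.sqrt_nonneg _
    rw [mem_closedBall_zero_iff, norm_prod_le_iff, pi_norm_le_iff_of_nonneg hR0,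
      pi_norm_le_iff_of_nonneg hR0]
    refine ⟨fun i => ?_, fun i => ?_⟩
    · obtain ⟨j, hij⟩ := hG.exists_adj i
      have h1 : ‖y (k + 1) i - y (k + 1) j‖ ≤ R := by
        refine hbound (k := k) ?_
        have h := (le_add_of_nonneg_right (by positivity)).trans
          (le_sum_sum_neighborFinset (φ := fun i j => ‖y (k + 1) i - y (k + 1) j‖ ^ 2
            + ‖(y (k + 1) i + y (k + 1) j) - (y k i + y k j)‖ ^ 2)
            (fun _ _ => by positivity) hij)
        have h' := step₀ k
        have := he0 (k + 1)
        simp only [he, hD] at *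
        linarith
      have h2 : ‖y (k + 1) i + y (k + 1) j - (2 : ℝ) • c₀‖ ≤ R :=
        hbound (k := k + 1) (norm_sq_sum_le_consensusEnergy _ _ _ _ hij)
      have h3 : (2 : ℝ) • (y (k + 1) i - c₀) = (y (k + 1) i - y (k + 1) j)
          + (y (k + 1) i + y (k + 1) j - (2 : ℝ) • c₀) := by
        simp only [two_smul]; abel
      have h4 := norm_add_le (y (k + 1) i - y (k + 1) j)
        (y (k + 1) i + y (k + 1) j - (2 : ℝ) • c₀)
      rw [← h3, norm_smul, Real.norm_two] at h4
      show ‖y (k + 1) i - c₀‖ ≤ R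
      linarith
    · rw [pi_norm_le_iff_of_nonneg hR0]
      intro j
      by_cases hij : G.Adj i j
      · simp only [X, if_pos hij]
        exact hbound (k := k + 1) (norm_sq_flow_le_consensusEnergy _ _ _ _ hij)
      · simpa [X, if_neg hij] using hR0
  obtain ⟨⟨a, v⟩, -, φ, hφ, hlim⟩ := tendsto_subseq_of_bounded Metric.isBounded_closedBall hX
  have hy : ∀ i, Tendsto (fun n => y (φ n + 1) i) atTop (𝓝 (a i + c₀)) := fun i => by
    have h := ((tendsto_pi_nhds.mp ((Prod.tendsto_iff _ _).mp hlim).1) i).add_const c₀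
    simpa [X] using h
  have hv : ∀ i j, G.Adj i j →
      Tendsto (fun n => u (φ n + 2) i j) atTop (𝓝 (v i j + w₀ i j)) := fun i j hij => by
    have h := (tendsto_pi_nhds.mp ((tendsto_pi_nhds.mp ((Prod.tendsto_iff _ _).mp hlim).2) i)
      j).add_const (w₀ i j)
    simpa [X, hij] using h
  have hconst : ∀ i j, a i + c₀ = a j + c₀ := hG.eq_of_forall_adj fun i j hij =>
    sub_eq_zero.mp (tendsto_nhds_unique ((hy i).sub (hy j))
      ((hdiff i j hij).comp hφ.tendsto_atTop))
  obtain ⟨i₀⟩ := hG.nonempty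
  set c := a i₀ + c₀ with hc
  have hyc : ∀ i, Tendsto (fun n => y (φ n + 1) i) atTop (𝓝 c) := fun i => by
    rw [hc, ← hconst i i₀]; exact hy i
  set w : V → V → F := fun i j => v i j + w₀ i j with hwdef
  have hw : ∀ i j, G.Adj i j → w j i = -w i j := fun i j hij =>
    tendsto_nhds_unique (hv j i hij.symm) (by
      have h := (hv i j hij).neg
      simpa only [← hanti] using h)
  set sbar : V → F := fun i => -(ρ • ∑ j ∈ G.neighborFinset i, w i j) with hsbar
  have hslim : ∀ i, Tendsto (fun n => s (φ n + 1) i) atTop (𝓝 (sbar i)) := fun i => by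
    simp only [heq]
    refine ((tendsto_finsetSum _ fun j hj => ?_).const_smul ρ).neg
    have hij : G.Adj i j := by simpa using hj
    simpa using (hv i j hij).add ((hchange i j hij).comp hφ.tendsto_atTop)
  have hcs : ∀ i, (c, sbar i) ∈ S i := fun i =>
    (hclosed i).mem_of_tendsto ((hyc i).prodMk_nhds (hslim i))
      (Eventually.of_forall fun n => hS (φ n) i)
  -- Opial-type argument: the cluster point is itself admissible as reference, so the energy
  -- relative to it is antitone, and one subsequence with limit 0 suffices.
  have anti₁ := anti c sbar w hcs hw (fun i => neg_add_cancel _)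
  have hElim : Tendsto (fun k => consensusEnergy G (y k) (u (k + 1)) c w) atTop (𝓝 0) := by
    refine (tendsto_iff_tendsto_subseq_of_antitone anti₁
      ((tendsto_add_atTop_nat 1).comp hφ.tendsto_atTop)).mpr ?_
    have h : Tendsto (fun n => consensusEnergy G (y (φ n + 1)) (u (φ n + 2)) c w) atTop
        (𝓝 (∑ i, ∑ j ∈ G.neighborFinset i,
          (‖w i j - w i j‖ ^ 2 + ‖c + c - (2 : ℝ) • c‖ ^ 2))) := by
      refine tendsto_finsetSum _ fun i _ => tendsto_finsetSum _ fun j hj => ?_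
      have hij : G.Adj i j := by simpa using hj
      exact (((hv i j hij).sub_const _).norm.pow 2).add
        ((((hyc i).add (hyc j)).sub_const _).norm.pow 2)
    simpa [two_smul, Function.comp_def] using h
  have hufin : ∀ i j, G.Adj i j → Tendsto (fun k => u (k + 1) i j) atTop (𝓝 (w i j)) :=
    fun i j hij => by
      have h := sq_lim (fun k => norm_sq_flow_le_consensusEnergy (y k) (u (k + 1)) c w hij) hElim
      exact tendsto_sub_nhds_zero_iff.mp h
  refine ⟨c, sbar, hcs, ?_, fun i => ?_, fun i => ?_⟩
  · simp only [hsbar, Finset.sum_neg_distrib, ← Finset.smul_sum]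
    rw [G.sum_sum_neighborFinset_eq_zero w hw]
    simp
  · obtain ⟨j, hij⟩ := hG.exists_adj i
    rw [← tendsto_add_atTop_iff_nat 1]
    have h1 := (sq_lim (fun k => norm_sq_sum_le_consensusEnergy (y k) (u (k + 1)) c w hij)
      hElim).comp (tendsto_add_atTop_nat 1)
    -- Uses y_i = c + ½((y_i - y_j) + (y_i + y_j - 2c)) for some neighbour j.
    have h2 := (((hdiff i j hij).add h1).const_smul (2⁻¹ : ℝ)).add_const c
    simp only [add_zero, smul_zero, zero_add] at h2
    refine h2.congr fun k => ?_
    simp only [Function.comp]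
    module
  · rw [← tendsto_add_atTop_iff_nat 1]
    simp only [heq]
    refine ((tendsto_finsetSum _ fun j hj => ?_).const_smul ρ).neg
    have hij : G.Adj i j := by simpa using hj
    simpa using ((hufin i j hij).comp (tendsto_add_atTop_nat 1)).add (hchange i j hij)

end Consensus

/-! ### Subgradients of extended-real-valued functions. -/

section Subgradient

variable {E : Type*} [NormedAddCommGroup E] [InnerProductSpace ℝ E]

/-- `s` is a subgradient of the extended-real-valued function `g` at the point `y`, where `g` is
finite. -/
def IsSubgradient (g : E → EReal) (y s : E) : Prop :=
  ∃ c : ℝ, g y = c ∧ ∀ (y' : E) (c' : ℝ), g y' ≤ c' → c + ⟪s, y' - y⟫_ℝ ≤ c'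

theorem EReal.coe_le_of_forall_le {c : ℝ} {z : EReal} (h : ∀ c' : ℝ, z ≤ c' → c ≤ c') :
    (c : EReal) ≤ z := by
  induction z with
  | bot => linarith [h (c - 1) bot_le]
  | coe z => exact EReal.coe_le_coe_iff.mpr (h z le_rfl)
  | top => exact le_top

theorem IsSubgradient.of_le {g : E → EReal} {y s : E} {c : ℝ} (hc : g y ≤ c)
    (h : ∀ (y' : E) (c' : ℝ), g y' ≤ c' → c + ⟪s, y' - y⟫_ℝ ≤ c') : IsSubgradient g y s :=
  ⟨c, hc.antisymm (EReal.coe_le_of_forall_le fun c' hc' => by simpa using h y c' hc'), h⟩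

theorem IsSubgradient.monotone {g : E → EReal} {y₁ s₁ y₂ s₂ : E} (h₁ : IsSubgradient g y₁ s₁)
    (h₂ : IsSubgradient g y₂ s₂) : 0 ≤ ⟪y₁ - y₂, s₁ - s₂⟫_ℝ := by
  obtain ⟨c₁, hc₁, h₁⟩ := h₁
  obtain ⟨c₂, hc₂, h₂⟩ := h₂
  have h12 := h₁ y₂ c₂ hc₂.le
  have h21 := h₂ y₁ c₁ hc₁.le
  rw [real_inner_comm, inner_sub_left]
  rw [← neg_sub y₁ y₂, inner_neg_right] at h12
  linarith

/-- The graph of the subdifferential of a closed proper function is closed. -/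
theorem isClosed_setOf_isSubgradient {g : E → EReal} (hg : IsClosed (epigraph g))
    (hbot : ∀ y, g y ≠ ⊥) (htop : ∃ y, g y ≠ ⊤) :
    IsClosed {q : E × E | IsSubgradient g q.1 q.2} := by
  -- Each subgradient inequality says that a point depending continuously on `(y, s)` lies in the
  -- epigraph; properness makes `g y` finite.
  have h : {q : E × E | IsSubgradient g q.1 q.2} = ⋂ (y' : E) (c' : ℝ) (_ : g y' ≤ c'),
      {q : E × E | (q.1, c' - ⟪q.2, y' - q.1⟫_ℝ) ∈ epigraph g} := by
    ext ⟨y, s⟩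
    simp only [Set.mem_ofPred_eq, Set.mem_iInter, epigraph]
    constructor
    · rintro ⟨c, hc, h⟩ y' c' hc'
      rw [hc, EReal.coe_le_coe_iff]
      linarith [h y' c' hc']
    · intro h
      obtain ⟨y₀, hy₀⟩ := htop
      have h₀ := h y₀ (g y₀).toReal (EReal.le_coe_toReal hy₀)
      have hy : g y ≠ ⊤ := ne_top_of_le_ne_top (EReal.coe_ne_top _) h₀
      refine ⟨(g y).toReal, (EReal.coe_toReal hy (hbot y)).symm, fun y' c' hc' => ?_⟩
      have h' := h y' c' hc'
      rw [← EReal.coe_toReal hy (hbot y), EReal.coe_le_coe_iff] at h'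
      linarith
  rw [h]
  refine isClosed_iInter fun y' => isClosed_iInter fun c' => isClosed_iInter fun _ => ?_
  exact hg.preimage (by fun_prop)

end Subgradient

/-! ### Finiteness of extended-real sums, and conjugates. -/

section ERealSum

variable {ι : Type*} [Fintype ι]

theorem EReal.sum_coe (c : ι → ℝ) : ∑ i, (c i : EReal) = ((∑ i, c i : ℝ) : EReal) := by
  classical
  induction (Finset.univ : Finset ι) using Finset.induction_on with
  | empty => simp
  | insert a s ha ih => rw [Finset.sum_insert ha, Finset.sum_insert ha, ih, EReal.coe_add]

theorem EReal.sum_ne_bot {a : ι → EReal} (ha : ∀ i, a i ≠ ⊥) : ∑ i, a i ≠ ⊥ := by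
  classical
  induction (Finset.univ : Finset ι) using Finset.induction_on with
  | empty => simp
  | insert i s hi ih => rw [Finset.sum_insert hi]; exact EReal.add_ne_bot_iff.mpr ⟨ha i, ih⟩

theorem EReal.exists_coe_of_sum_ne_top {a : ι → EReal} (ha : ∀ i, a i ≠ ⊥)
    (h : ∑ i, a i ≠ ⊤) : ∃ c : ι → ℝ, ∀ i, a i = c i := by
  classical
  refine ⟨fun i => (a i).toReal, fun i => (EReal.coe_toReal (fun hi => h ?_) (ha i)).symm⟩
  rw [← Finset.add_sum_erase _ _ (Finset.mem_univ i), hi]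
  refine EReal.top_add_of_ne_bot ?_
  induction (Finset.univ.erase i) using Finset.induction_on with
  | empty => simp
  | insert j s hj ih => rw [Finset.sum_insert hj]; exact EReal.add_ne_bot_iff.mpr ⟨ha j, ih⟩

end ERealSum

section Conjugate

variable {E : Type*} [NormedAddCommGroup E] [InnerProductSpace ℝ E]

theorem conjugate_le_coe_iff {f : E → EReal} (hf : ∀ x, f x ≠ ⊥) {u : E} {c : ℝ} :
    conjugate f u ≤ c ↔ ∀ (x : E) (a : ℝ), f x ≤ a → ⟪u, x⟫_ℝ - a ≤ c := by
  rw [conjugate, iSup_le_iff]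
  refine forall_congr' fun x => ?_
  have hx := hf x
  generalize f x = z at hx
  induction z with
  | bot => exact absurd rfl hx
  | coe z =>
    rw [← EReal.coe_sub, EReal.coe_le_coe_iff]
    exact ⟨fun h a ha => by linarith [EReal.coe_le_coe_iff.mp ha], fun h => h z le_rfl⟩
  | top => simp

theorem conjugate_ne_bot {f : E → EReal} (hf : ∀ x, f x ≠ ⊥) (hf' : ∃ x, f x ≠ ⊤) (u : E) :
    conjugate f u ≠ ⊥ := by
  intro h
  obtain ⟨x, hx⟩ := hf'
  have h' := (conjugate_le_coe_iff hf (u := u)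
    (c := ⟪u, x⟫_ℝ - (f x).toReal - 1)).mp (h ▸ bot_le) x _ (EReal.le_coe_toReal hx)
  linarith

end Conjugate

/-! ### Closed cones and the Moreau decomposition. -/

section Cone

variable {F : Type*} [NormedAddCommGroup F] [InnerProductSpace ℝ F]

/-- A `ConvexCone` is stable under positive scalars only; 0 is reached as the limit of c • v for c ↓
0. -/
theorem ConvexCone.zero_mem_of_nonempty_of_isClosed {K : ConvexCone ℝ F} (hne : (K : Set F).Nonempty)
    (hK : IsClosed (K : Set F)) : (0 : F) ∈ K := by
  obtain ⟨v, hv⟩ := hne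
  have h : Tendsto (fun c : ℝ => c • v) (𝓝[>] 0) (𝓝 0) := by
    have h' : Tendsto (fun c : ℝ => c • v) (𝓝 0) (𝓝 ((0 : ℝ) • v)) :=
      (continuous_id.smul continuous_const).tendsto 0
    rw [zero_smul] at h'
    exact h'.mono_left nhdsWithin_le_nhds
  exact hK.mem_of_tendsto h (eventually_nhdsWithin_of_forall fun c hc => K.smul_mem hc hv)

/-- Moreau decomposition: `v = z - t` is the projection of `z` on the polar cone. -/
theorem eq_of_isProjection_polarCone {K : Set F} {z t v q : F} (hz : z = t + v) (ht : t ∈ K)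
    (hv : v ∈ polarCone K) (htv : ⟪t, v⟫_ℝ = 0) (hq : IsProjection (polarCone K) z q) :
    q = v := by
  have h1 : ‖z - q‖ ≤ ‖z - v‖ := isMinOn_iff.mp hq.2 v hv
  have h2 : z - v = t := by rw [hz]; abel
  have h3 : z - q = t + (v - q) := by rw [hz]; abel
  have h4 : ⟪t, q⟫_ℝ ≤ 0 := hq.1 t ht
  have h5 : ‖z - q‖ ^ 2 ≤ ‖z - v‖ ^ 2 := by gcongr
  rw [h2, h3, norm_add_sq_real, inner_sub_right, htv] at h5
  have h6 : ‖v - q‖ = 0 := by nlinarith [norm_nonneg (v - q)]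
  exact (sub_eq_zero.mp (norm_eq_zero.mp h6)).symm

/-- Extracts first-order optimality conditions: divide by θ and let θ tend to 0. -/
theorem nonneg_of_forall_small {a b : ℝ} (h : ∀ θ : ℝ, 0 < θ → θ ≤ 1 → 0 ≤ θ * a + θ ^ 2 * b) :
    0 ≤ a := by
  by_contra! ha
  have hb : 0 < |b| + 1 := by positivity
  set θ := min 1 (-a / (2 * (|b| + 1))) with hθ
  have hpos : 0 < θ := lt_min one_pos (by apply div_pos <;> linarith)
  have h1 : θ * (2 * (|b| + 1)) ≤ -a := by
    rw [← le_div_iff₀ (by positivity)]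
    exact min_le_right _ _
  have h2 := h θ hpos (min_le_left _ _)
  have h3 : θ * b ≤ θ * |b| := by gcongr; exact le_abs_self b
  nlinarith

end Cone

/-! ### Local optimality conditions and Lagrangian duality. -/

namespace ResourceProblem

variable {V : Type*} {E : V → Type*} {F : Type*}
  [∀ i, NormedAddCommGroup (E i)] [∀ i, InnerProductSpace ℝ (E i)]
  [∀ i, FiniteDimensional ℝ (E i)]
  [NormedAddCommGroup F] [InnerProductSpace ℝ F] [FiniteDimensional ℝ F]
  (P : ResourceProblem V E F)

/-- The contribution of agent `i` to the negative of the dual objective. -/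
noncomputable def dualTerm (i : V) (y : F) : EReal :=
  conjugate (P.f i) (-(LinearMap.adjoint (P.A i) y)) + ((inner ℝ y (P.b i) : ℝ) : EReal)
    + indicatorFn (polarCone (P.K : Set F)) y

variable {P}

/-- Reduces the epigraph of the dual term to real inequalities affine in `(y, c)`, together with
membership in the polar cone. -/
theorem dualTerm_le_coe_iff {i : V} (hf : IsConvexClosedProper (P.f i)) {y : F} {c : ℝ} :
    P.dualTerm i y ≤ c ↔ y ∈ polarCone (P.K : Set F) ∧ ∀ (x : E i) (a : ℝ), P.f i x ≤ a →
      -⟪y, P.A i x⟫_ℝ - a + ⟪y, P.b i⟫_ℝ ≤ c := by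
  by_cases hy : y ∈ polarCone (P.K : Set F)
  · have h : P.dualTerm i y ≤ c ↔ conjugate (P.f i) (-(LinearMap.adjoint (P.A i) y))
        ≤ ((c - ⟪y, P.b i⟫_ℝ : ℝ) : EReal) := by
      rw [dualTerm, indicatorFn, if_pos hy, add_zero, EReal.coe_sub,
        EReal.le_sub_iff_add_le (Or.inl (EReal.coe_ne_bot _)) (Or.inl (EReal.coe_ne_top _))]
    rw [h, conjugate_le_coe_iff hf.ne_bot]
    simp only [hy, true_and, inner_neg_left, LinearMap.adjoint_inner_left]
    exact forall_congr' fun x => forall_congr' fun a => imp_congr_right fun _ => le_sub_iff_add_le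
  · have h : P.dualTerm i y = ⊤ := by
      rw [dualTerm, indicatorFn, if_neg hy]
      exact EReal.add_top_of_ne_bot (EReal.add_ne_bot_iff.mpr
        ⟨conjugate_ne_bot hf.ne_bot hf.exists_ne_top _, EReal.coe_ne_bot _⟩)
    simp [h, hy]

theorem dualTerm_ne_bot {i : V} (hf : IsConvexClosedProper (P.f i)) (y : F) :
    P.dualTerm i y ≠ ⊥ := by
  intro h
  obtain ⟨x, hx⟩ := hf.exists_ne_top
  have h' := ((dualTerm_le_coe_iff hf (y := y)
    (c := -⟪y, P.A i x⟫_ℝ - (P.f i x).toReal + ⟪y, P.b i⟫_ℝ - 1)).mp (h ▸ bot_le)).2 x _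
    (EReal.le_coe_toReal hx)
  linarith

theorem isClosed_epigraph_dualTerm {i : V} (hf : IsConvexClosedProper (P.f i)) :
    IsClosed (epigraph (P.dualTerm i)) := by
  have h : epigraph (P.dualTerm i) = (⋂ v ∈ P.K, {q : F × ℝ | ⟪v, q.1⟫_ℝ ≤ 0}) ∩
      ⋂ (x : E i) (a : ℝ) (_ : P.f i x ≤ a),
        {q : F × ℝ | -⟪q.1, P.A i x⟫_ℝ - a + ⟪q.1, P.b i⟫_ℝ ≤ q.2} := by
    ext q
    simp [epigraph, dualTerm_le_coe_iff hf, polarCone]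
  rw [h]
  refine IsClosed.inter ?_ ?_
  · exact isClosed_biInter fun v _ => isClosed_le (by fun_prop) (by fun_prop)
  · exact isClosed_iInter fun x => isClosed_iInter fun a => isClosed_iInter fun _ =>
      isClosed_le (by fun_prop) (by fun_prop)

/-- A subgradient of the dual term obtained from a primal point and a complementary slack. -/
theorem isSubgradient_dualTerm {i : V} (hf : IsConvexClosedProper (P.f i)) {x : E i} {y t : F}
    (hx : IsSubgradient (P.f i) x (-(LinearMap.adjoint (P.A i) y))) (ht : t ∈ P.K)
    (hy : y ∈ polarCone (P.K : Set F)) (hty : ⟪t, y⟫_ℝ = 0) :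
    IsSubgradient (P.dualTerm i) y (P.b i + t - P.A i x) := by
  obtain ⟨φ, hφ, hx⟩ := hx
  -- This `c` is the value at `y` of the affine minorant contributed by `x`, which attains the
  -- conjugate. Adding ⟪t, ·⟫ keeps it a minorant on the polar cone and, by complementarity, tight
  -- at `y`.
  refine IsSubgradient.of_le (c := -⟪y, P.A i x⟫_ℝ - φ + ⟪y, P.b i⟫_ℝ)
    ((dualTerm_le_coe_iff hf).mpr ⟨hy, fun x' a ha => ?_⟩) fun y' c' hc' => ?_
  · have h := hx x' a ha
    rw [inner_neg_left, LinearMap.adjoint_inner_left, map_sub, inner_sub_right] at h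
    linarith
  · obtain ⟨hy', h⟩ := (dualTerm_le_coe_iff hf).mp hc'
    have h1 := h x φ hφ.le
    have h2 : ⟪t, y'⟫_ℝ ≤ 0 := hy' t ht
    rw [inner_sub_right, inner_sub_left, inner_sub_left, inner_add_left, inner_add_left, hty,
      real_inner_comm y', real_inner_comm y, real_inner_comm y (P.A i x),
      real_inner_comm y' (P.A i x)]
    linarith

/-- The optimality conditions of the local subproblem. -/
theorem localObj_optimality {i : V} (hf : IsConvexClosedProper (P.f i)) (h0 : (0 : F) ∈ P.K)
    {ρ : ℝ} (hρ : 0 < ρ) {d : ℕ} (hd : 0 < d) {r : F} {x : E i} {t : F}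
    (hmin : IsMinOn (P.localObj ρ d i r) Set.univ (x, t)) {v : F}
    (hv : v = P.A i x + r - t) :
    t ∈ P.K ∧ v ∈ polarCone (P.K : Set F) ∧ ⟪t, v⟫_ℝ = 0 ∧ IsSubgradient (P.f i) x
      (-(LinearMap.adjoint (P.A i) ((1 / (2 * ρ * (d : ℝ))) • v))) := by
  set γ : ℝ := 1 / (4 * ρ * (d : ℝ)) with hγ
  have hd' : (0 : ℝ) < d := by exact_mod_cast hd
  have hγpos : 0 < γ := by positivity
  have h2γ : 1 / (2 * ρ * (d : ℝ)) = 2 * γ := by rw [hγ]; field_simp; norm_num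
  have hmin' := fun q => isMinOn_iff.mp hmin q (Set.mem_univ q)
  have hval : ∀ (ξ : E i) (c : ℝ) (τ : F), P.f i ξ ≤ c → τ ∈ P.K →
      P.localObj ρ d i r (x, t) ≤ ((c + γ * ‖P.A i ξ + r - τ‖ ^ 2 : ℝ) : EReal) := by
    intro ξ c τ hc hτ
    refine (hmin' (ξ, τ)).trans ?_
    have hτ' : τ ∈ (P.K : Set F) := hτ
    simp only [localObj, indicatorFn, if_pos hτ', add_zero]
    rw [EReal.coe_add]
    exact add_le_add_left hc _
  have hlt : P.localObj ρ d i r (x, t) ≠ ⊤ := by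
    obtain ⟨ξ, hξ⟩ := hf.exists_ne_top
    exact ne_top_of_le_ne_top (EReal.coe_ne_top _) (hval ξ _ 0 (EReal.le_coe_toReal hξ) h0)
  have ht : t ∈ (P.K : Set F) := by
    by_contra ht
    refine hlt ?_
    simp only [localObj, indicatorFn, if_neg ht]
    rw [EReal.add_top_of_ne_bot (hf.ne_bot x)]
    exact EReal.top_add_coe _
  have hx : P.f i x ≠ ⊤ := by
    intro hx
    refine hlt ?_
    simp only [localObj, indicatorFn, if_pos ht, hx, add_zero]
    exact EReal.top_add_coe _
  set φ : ℝ := (P.f i x).toReal with hφ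
  have hφx : P.f i x = φ := (EReal.coe_toReal hx (hf.ne_bot x)).symm
  have hreal : ∀ (ξ : E i) (c : ℝ) (τ : F), P.f i ξ ≤ c → τ ∈ P.K →
      φ + γ * ‖v‖ ^ 2 ≤ c + γ * ‖P.A i ξ + r - τ‖ ^ 2 := by
    intro ξ c τ hc hτ
    have h := hval ξ c τ hc hτ
    simp only [localObj, indicatorFn, if_pos ht, add_zero, hφx] at h
    rw [← EReal.coe_add, EReal.coe_le_coe_iff] at h
    rw [hv]
    exact h
  -- First-order condition along the segment from `(x, φ, t)` to `(ξ, c, τ)` in the product of the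
  -- epigraph and K. Taking ξ = x, then τ = t, separates the two variables.
  have hvar : ∀ (ξ : E i) (c : ℝ) (τ : F), P.f i ξ ≤ c → τ ∈ P.K →
      0 ≤ (c - φ) + 2 * γ * ⟪v, P.A i (ξ - x) - (τ - t)⟫_ℝ := by
    intro ξ c τ hc hτ
    refine nonneg_of_forall_small (b := γ * ‖P.A i (ξ - x) - (τ - t)‖ ^ 2) fun θ hθ hθ1 => ?_
    have hepi : ((1 - θ) • (x, φ) + θ • (ξ, c)) ∈ epigraph (P.f i) :=
      hf.convex (x := (x, φ)) hφx.le (y := (ξ, c)) hc (by linarith) hθ.le (by ring)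
    have hKc : (1 - θ) • t + θ • τ ∈ (P.K : Set F) :=
      P.K.convex ht hτ (by linarith) hθ.le (by ring)
    have h := hreal ((1 - θ) • x + θ • ξ) ((1 - θ) * φ + θ * c) _ hepi hKc
    have he : P.A i ((1 - θ) • x + θ • ξ) + r - ((1 - θ) • t + θ • τ)
        = v + θ • (P.A i (ξ - x) - (τ - t)) := by
      rw [hv, map_add, map_smul, map_smul, map_sub]
      module
    rw [he, norm_add_sq_real, inner_smul_right, norm_smul, mul_pow, Real.norm_eq_abs,
      sq_abs] at h
    linarith
  have hcone : ∀ τ ∈ P.K, ⟪v, τ - t⟫_ℝ ≤ 0 := by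
    intro τ hτ
    have h := hvar x φ τ hφx.le hτ
    rw [sub_self, sub_self, map_zero, zero_sub, inner_neg_right, zero_add] at h
    by_contra! hc
    have := mul_pos hγpos hc
    linarith
  have htv : ⟪t, v⟫_ℝ = 0 := by
    rw [real_inner_comm]
    -- Testing with 0 and 2t, both in the cone, bounds ⟪v, t⟫ from both sides.
    have h1 := hcone 0 h0
    have h2 := hcone ((2 : ℝ) • t) (P.K.smul_mem two_pos ht)
    rw [two_smul, add_sub_cancel_right] at h2
    rw [zero_sub, inner_neg_right] at h1
    linarith
  refine ⟨ht, fun τ hτ => ?_, htv, φ, hφx, fun ξ c hc => ?_⟩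
  · have h := hcone τ hτ
    rw [inner_sub_right, real_inner_comm t v, htv] at h
    rw [real_inner_comm]
    linarith
  · have h := hvar ξ c t hc ht
    rw [sub_self, sub_zero] at h
    rw [inner_neg_left, LinearMap.adjoint_inner_left, h2γ, inner_smul_left]
    simp only [conj_trivial]
    linarith

variable [Fintype V]

theorem dualObj_eq_neg_sum_dualTerm (y : F) : P.dualObj y = -∑ i, P.dualTerm i y := rfl

/-- A consensus zero of the sum of the dual subdifferentials solves the dual problem. -/
theorem isDualSolution_of_isSubgradient {y : F} {s : V → F}
    (hs : ∀ i, IsSubgradient (P.dualTerm i) y (s i)) (hsum : ∑ i, s i = 0) :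
    P.IsDualSolution y := by
  refine isMaxOn_iff.mpr fun y' _ => ?_
  rw [dualObj_eq_neg_sum_dualTerm, dualObj_eq_neg_sum_dualTerm, EReal.neg_le_neg_iff]
  choose c hc h using hs
  calc ∑ i, P.dualTerm i y = ((∑ i, c i : ℝ) : EReal) := by
        rw [← EReal.sum_coe]; exact Finset.sum_congr rfl fun i _ => hc i
    _ = ((∑ i, (c i + ⟪s i, y' - y⟫_ℝ) : ℝ) : EReal) := by
        rw [Finset.sum_add_distrib, ← sum_inner, hsum, inner_zero_left, add_zero]
    _ = ∑ i, ((c i + ⟪s i, y' - y⟫_ℝ : ℝ) : EReal) := (EReal.sum_coe _).symm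
    _ ≤ ∑ i, P.dualTerm i y' := Finset.sum_le_sum fun i _ =>
        EReal.coe_le_of_forall_le fun c' hc' => h i y' c' hc'

/-- The standing assumptions provide a consensus zero of the dual subdifferentials. -/
theorem StandingAssumption.exists_isSubgradient [Nonempty V] (hP : P.StandingAssumption) :
    ∃ (y : F) (s : V → F), (∀ i, IsSubgradient (P.dualTerm i) y (s i)) ∧ ∑ i, s i = 0 := by
  obtain ⟨x, y, ⟨hxf, -⟩, -, hxy⟩ := hP.primal_dual
  have hf := hP.convexClosedProper
  rw [dualObj_eq_neg_sum_dualTerm] at hxy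
  have hg : ∀ i, P.dualTerm i y ≠ ⊥ := fun i => dualTerm_ne_bot (hf i) y
  obtain ⟨φ, hφ⟩ := EReal.exists_coe_of_sum_ne_top (a := fun i => P.f i (x i))
    (fun i => (hf i).ne_bot _) (by
      change P.primalObj x ≠ ⊤
      rw [hxy, Ne, EReal.neg_eq_top_iff]
      exact EReal.sum_ne_bot hg)
  obtain ⟨c, hc⟩ := EReal.exists_coe_of_sum_ne_top hg (by
    rw [Ne, ← EReal.neg_eq_bot_iff, ← hxy]
    exact EReal.sum_ne_bot fun i => (hf i).ne_bot _)
  have hsum : ∑ i, φ i = -∑ i, c i := by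
    simp only [primalObj, hφ, hc, EReal.sum_coe] at hxy
    exact_mod_cast hxy
  set τ : F := ∑ i, (P.A i (x i) - P.b i) with hτ
  have hτK : τ ∈ P.K := hxf
  have hle := fun i => (dualTerm_le_coe_iff (hf i)).mp (hc i).le
  obtain ⟨i₀⟩ := ‹Nonempty V›
  have hy := (hle i₀).1
  have hτy : ⟪τ, y⟫_ℝ ≤ 0 := hy τ hτK
  -- Fenchel–Young for each agent. The zero gap makes the right sides sum to 0, while the left sides
  -- sum to -⟪τ, y⟫ ≥ 0, so every inequality is an equality.
  have hle' : ∀ i, -⟪y, P.A i (x i) - P.b i⟫_ℝ ≤ φ i + c i := fun i => by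
    have h := (hle i).2 (x i) (φ i) (hφ i).le
    rw [inner_sub_right]
    linarith
  have hsum' : ∑ i, -⟪y, P.A i (x i) - P.b i⟫_ℝ = -⟪τ, y⟫_ℝ := by
    rw [Finset.sum_neg_distrib, ← inner_sum, real_inner_comm]
  have hsumle := Finset.sum_le_sum fun i (_ : i ∈ Finset.univ) => hle' i
  have hzero : ∑ i, (φ i + c i) = 0 := by rw [Finset.sum_add_distrib, hsum, neg_add_cancel]
  have hτ0 : ⟪τ, y⟫_ℝ = 0 := by linarith
  have heq : ∀ i, -⟪y, P.A i (x i) - P.b i⟫_ℝ = φ i + c i := fun i =>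
    (Finset.sum_eq_sum_iff_of_le fun i _ => hle' i).mp (by linarith) i (Finset.mem_univ i)
  have hN : (0 : ℝ) < Fintype.card V := by
    exact_mod_cast Fintype.card_pos_iff.mpr ⟨i₀⟩
  -- The slack τ is shared equally: each share stays in K and orthogonal to `y`, and the shares sum
  -- to τ.
  refine ⟨y, fun i => P.b i + (Fintype.card V : ℝ)⁻¹ • τ - P.A i (x i), fun i =>
    isSubgradient_dualTerm (hf i) ⟨φ i, hφ i, fun ξ a ha => ?_⟩
      (P.K.smul_mem (inv_pos.mpr hN) hτK) hy ?_, ?_⟩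
  · have h1 := (hle i).2 ξ a ha
    have h2 := heq i
    rw [inner_sub_right] at h2
    rw [inner_neg_left, LinearMap.adjoint_inner_left, map_sub, inner_sub_right]
    linarith
  · rw [inner_smul_left, hτ0, mul_zero]
  · have h : ∀ i, P.b i + (Fintype.card V : ℝ)⁻¹ • τ - P.A i (x i)
        = (Fintype.card V : ℝ)⁻¹ • τ - (P.A i (x i) - P.b i) := fun i => by abel
    simp only [h]
    rw [Finset.sum_sub_distrib, ← hτ, Finset.sum_const, Finset.card_univ,
      ← Nat.cast_smul_eq_nsmul ℝ, smul_inv_smul₀ hN.ne', sub_self]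

/-- Feasibility, stationarity and complementary slackness imply primal optimality. -/
theorem isPrimalSolution_of_isSubgradient {x : ∀ i, E i} {y : F} {t : V → F}
    (hx : ∀ i, IsSubgradient (P.f i) (x i) (-(LinearMap.adjoint (P.A i) y)))
    (h0 : (0 : F) ∈ P.K) (ht : ∀ i, t i ∈ P.K) (hty : ∀ i, ⟪t i, y⟫_ℝ = 0)
    (hy : y ∈ polarCone (P.K : Set F))
    (hsum : ∑ i, t i = ∑ i, (P.A i (x i) - P.b i)) : P.IsPrimalSolution x := by
  refine ⟨?_, isMinOn_iff.mpr fun x' hx' => ?_⟩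
  · change ∑ i, (P.A i (x i) - P.b i) ∈ P.K
    rw [← hsum]
    exact Finset.sum_induction _ (· ∈ P.K) (fun a b ha hb => P.K.add_mem ha hb) h0
      fun i _ => ht i
  · choose c hc h using hx
    have hy' : ⟪∑ i, (P.A i (x' i) - P.b i), y⟫_ℝ ≤ 0 := hy _ hx'
    have hzero : ⟪∑ i, (P.A i (x i) - P.b i), y⟫_ℝ = 0 := by
      rw [← hsum, sum_inner]
      exact Finset.sum_eq_zero fun i _ => hty i
    calc P.primalObj x = ((∑ i, c i : ℝ) : EReal) := by
          rw [← EReal.sum_coe]; exact Finset.sum_congr rfl fun i _ => hc i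
      _ ≤ ((∑ i, (c i + ⟪-(LinearMap.adjoint (P.A i) y), x' i - x i⟫_ℝ) : ℝ) : EReal) := by
          rw [EReal.coe_le_coe_iff, Finset.sum_add_distrib, le_add_iff_nonneg_right]
          have he : ∑ i, ⟪-(LinearMap.adjoint (P.A i) y), x' i - x i⟫_ℝ
              = ⟪∑ i, (P.A i (x i) - P.b i), y⟫_ℝ - ⟪∑ i, (P.A i (x' i) - P.b i), y⟫_ℝ := by
            rw [sum_inner, sum_inner, ← Finset.sum_sub_distrib]
            refine Finset.sum_congr rfl fun i _ => ?_
            rw [inner_neg_left, LinearMap.adjoint_inner_left, ← inner_sub_left,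
              real_inner_comm, ← inner_neg_left, map_sub]
            congr 1
            abel
          linarith
      _ = ∑ i, ((c i + ⟪-(LinearMap.adjoint (P.A i) y), x' i - x i⟫_ℝ : ℝ) : EReal) :=
          (EReal.sum_coe _).symm
      _ ≤ P.primalObj x' := Finset.sum_le_sum fun i _ =>
          EReal.coe_le_of_forall_le fun c' hc' => h i _ c' hc'

end ResourceProblem

/-! ### The ADMM as a consensus iteration, and the limit points of x. -/

theorem proposition1 {V : Type*} [Fintype V] [Nontrivial V] {E : V → Type*} {F : Type*}
    [∀ i, NormedAddCommGroup (E i)] [∀ i, InnerProductSpace ℝ (E i)]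
    [∀ i, FiniteDimensional ℝ (E i)]
    [NormedAddCommGroup F] [InnerProductSpace ℝ F] [FiniteDimensional ℝ F]
    (P : ResourceProblem V E F) (hP : P.StandingAssumption)
    (G : SimpleGraph V) [DecidableRel G.Adj] (hG : G.Connected)
    (ρ : ℝ) (hρ : 0 < ρ)
    (p r : ℕ → V → F) (x : ℕ → ∀ i, E i) (t y : ℕ → V → F)
    (hrun : P.IsAggregateADMM G ρ p r x t y) :
    (∃ ystar : F, P.IsDualSolution ystar ∧
      ∀ i, Tendsto (fun k => y k i) atTop (𝓝 ystar)) ∧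
    (∀ xbar : ∀ i, E i, MapClusterPt xbar atTop x → P.IsPrimalSolution xbar) := by
  have hf := hP.convexClosedProper
  have h0 := ConvexCone.zero_mem_of_nonempty_of_isClosed hP.cone_nonempty hP.cone_closed
  have hlocal : ∀ k i, t (k + 1) i ∈ P.K ∧ y (k + 1) i ∈ polarCone (P.K : Set F) ∧
      ⟪t (k + 1) i, y (k + 1) i⟫_ℝ = 0 ∧
      IsSubgradient (P.f i) (x (k + 1) i) (-(LinearMap.adjoint (P.A i) (y (k + 1) i))) ∧
      (2 * ρ * (G.degree i : ℝ)) • y (k + 1) i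
        = P.A i (x (k + 1) i) + r (k + 1) i - t (k + 1) i := by
    intro k i
    have hd := hG.degree_pos i
    have hd' : (0 : ℝ) < 2 * ρ * (G.degree i : ℝ) := by
      have : (0 : ℝ) < G.degree i := by exact_mod_cast hd
      positivity
    obtain ⟨ht, hv, htv, hsub⟩ := ResourceProblem.localObj_optimality (hf i) h0 hρ hd
      (hrun.xt_succ k i) rfl
    obtain ⟨q, hq, hyq⟩ := hrun.y_succ k i
    -- Local optimality makes t and A x + r - t the two Moreau parts, so the projection is the
    -- second one for any choice of minimizer.
    have hqv := eq_of_isProjection_polarCone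
      (add_sub_cancel (t (k + 1) i) _).symm ht hv htv hq
    rw [← hqv] at hv htv hsub
    rw [← hqv, hyq]
    refine ⟨ht, fun a ha => ?_, ?_, hsub, ?_⟩
    · rw [inner_smul_right]
      exact mul_nonpos_of_nonneg_of_nonpos (by positivity) (hv a ha)
    · rw [inner_smul_right, htv, mul_zero]
    · rw [one_div, smul_inv_smul₀ hd'.ne']
  set s : ℕ → V → F := fun k i => P.b i + t k i - P.A i (x k i) with hs
  obtain ⟨c, sbar, hsub, hsum, hy, hslim⟩ := exists_tendsto_of_consensus_iteration hG hρ
    (S := fun i => {q : F × F | IsSubgradient (P.dualTerm i) q.1 q.2})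
    (fun i => by
      obtain ⟨y₀, s₀, h, -⟩ := hP.exists_isSubgradient
      obtain ⟨c₀, hc₀, -⟩ := h i
      exact isClosed_setOf_isSubgradient (ResourceProblem.isClosed_epigraph_dualTerm (hf i))
        (ResourceProblem.dualTerm_ne_bot (hf i)) ⟨y₀, hc₀ ▸ EReal.coe_ne_top _⟩)
    (fun i a ha b hb => IsSubgradient.monotone ha hb)
    hP.exists_isSubgradient hrun.p_zero hrun.p_succ (s := s)
    (fun k i => by
      have h := (hlocal k i).2.2.2.2
      have hdeg : (2 * ρ * (G.degree i : ℝ)) • y (k + 1) i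
          = ρ • ∑ j ∈ G.neighborFinset i, (2 : ℝ) • y (k + 1) i := by
        rw [Finset.sum_const, G.card_neighborFinset_eq_degree, ← Nat.cast_smul_eq_nsmul ℝ,
          smul_smul, smul_smul]
        congr 1
        ring
      have hs' : s (k + 1) i = ρ • ∑ j ∈ G.neighborFinset i, (y k i + y k j) - p (k + 1) i
          - ρ • ∑ j ∈ G.neighborFinset i, (2 : ℝ) • y (k + 1) i := by
        rw [← hdeg, h, hrun.r_succ]
        simp only [hs]
        abel
      -- The terms cancel for each neighbour; after scaling by ρ they account for r^{k+1}, the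
      -- y-update, the increment p^{k+2} - p^{k+1} and the change of the edge sums.
      have hz : ∑ j ∈ G.neighborFinset i, ((y k i + y k j) - (2 : ℝ) • y (k + 1) i
          + (y (k + 1) i - y (k + 1) j)
          + ((y (k + 1) i + y (k + 1) j) - (y k i + y k j))) = 0 :=
        Finset.sum_eq_zero fun j _ => by rw [two_smul]; abel
      rw [Finset.sum_add_distrib, Finset.sum_add_distrib, Finset.sum_sub_distrib] at hz
      have hz' := congrArg (fun a => ρ • a) hz
      simp only [smul_add, smul_sub, smul_zero] at hz'
      rw [hs', hrun.p_succ (k + 1), ← hz']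
      abel)
    (fun k i => ResourceProblem.isSubgradient_dualTerm (hf i) (hlocal k i).2.2.2.1
      (hlocal k i).1 (hlocal k i).2.1 (hlocal k i).2.2.1)
  refine ⟨⟨c, ResourceProblem.isDualSolution_of_isSubgradient hsub hsum, hy⟩, fun xbar hx => ?_⟩
  obtain ⟨ψ, hψ, hxlim⟩ := hx.tendsto_subseq
  -- The shift keeps indices positive, since `x 0` and `t 0` are unconstrained.
  have hshift : Tendsto (fun n => ψ (n + 1)) atTop atTop :=
    hψ.tendsto_atTop.comp (tendsto_add_atTop_nat 1)
  have hψ1 : ∀ n, ∃ k, ψ (n + 1) = k + 1 := fun n =>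
    Nat.exists_eq_succ_of_ne_zero (by have := hψ.le_apply (x := n + 1); omega)
  have hlocal' : ∀ n i, t (ψ (n + 1)) i ∈ P.K ∧ ⟪t (ψ (n + 1)) i, y (ψ (n + 1)) i⟫_ℝ = 0 ∧
      IsSubgradient (P.f i) (x (ψ (n + 1)) i)
        (-(LinearMap.adjoint (P.A i) (y (ψ (n + 1)) i))) := fun n i => by
    obtain ⟨k, hk⟩ := hψ1 n
    rw [hk]
    exact ⟨(hlocal k i).1, (hlocal k i).2.2.1, (hlocal k i).2.2.2.1⟩
  have hxi : ∀ i, Tendsto (fun n => x (ψ (n + 1)) i) atTop (𝓝 (xbar i)) := fun i =>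
    (tendsto_pi_nhds.mp hxlim i).comp (tendsto_add_atTop_nat 1)
  have hyi : ∀ i, Tendsto (fun n => y (ψ (n + 1)) i) atTop (𝓝 c) := fun i =>
    (hy i).comp hshift
  -- No boundedness of t is needed: t = s - b + A x, where s converges and x converges along the
  -- subsequence.
  have hti : ∀ i, Tendsto (fun n => t (ψ (n + 1)) i) atTop
      (𝓝 (sbar i - P.b i + P.A i (xbar i))) := fun i => by
    have hA := ((P.A i).continuous_of_finiteDimensional.tendsto (xbar i)).comp (hxi i)
    refine ((((hslim i).comp hshift).sub_const (P.b i)).add hA).congr fun n => ?_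
    simp only [hs, Function.comp]
    abel
  refine ResourceProblem.isPrimalSolution_of_isSubgradient (y := c)
    (t := fun i => sbar i - P.b i + P.A i (xbar i)) (fun i => ?_) h0 (fun i => ?_)
    (fun i => ?_) ?_ ?_
  · have hadj := ((LinearMap.adjoint (P.A i)).continuous_of_finiteDimensional.tendsto c).comp
      (hyi i)
    exact (isClosed_setOf_isSubgradient (hf i).closed (hf i).ne_bot
      (hf i).exists_ne_top).mem_of_tendsto ((hxi i).prodMk_nhds hadj.neg)
      (Eventually.of_forall fun n => (hlocal' n i).2.2)
  · exact hP.cone_closed.mem_of_tendsto (hti i) (Eventually.of_forall fun n => (hlocal' n i).1)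
  · exact tendsto_nhds_unique ((hti i).inner (hyi i))
      (tendsto_const_nhds.congr fun n => ((hlocal' n i).2.1).symm)
  · obtain ⟨i₀⟩ := hG.nonempty
    obtain ⟨c₀, hc₀, -⟩ := hsub i₀
    exact ((ResourceProblem.dualTerm_le_coe_iff (hf i₀)).mp hc₀.le).1
  · simp only [Finset.sum_add_distrib, Finset.sum_sub_distrib, hsum]
    abel
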